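/- **Setting.** A problem $P=(X,f,\mathcal O)$ consists of a convex set $X\subseteq\mathbb R^n$, a function $f:\mathbb R^n\to\mathbb R$ that is convex on $X$ and attains its minimum on $X$, and an oracle $\mathcal O$ answering a query $x$ by $\mathcal O(x)$. Let $\mathcal F$ be a class of problems (with answers of a common type, which may depend on $n$). A (deterministic, black-box) base algorithm knows $X$ and chooses $x_{t+1}$ from $x_1,\mathcal O(x_1),\dots,x_t,\mathcal O(x_t)$. A (deterministic) FMAB algorithm with $K\ge1$ arms knows the decision sets $X_1,\dots,X_K$ of a family $P_1,\dots,P_K\in\mathcal F$; in each round $t$ it chooses, from all its past choices and the answers received, an arm $i_t\in\{1,\dots,K\}$ and a point $x_t$, and receives $\mathcal O_{i_t}(x_t)$. All queries are required to be feasible ($x_t\in X$, resp. $x_t\in X_{i_t}$) on all problems (resp. families) from $\mathcal F$. The regret is $R_O(T)=\sum_{t=1}^T\bigl(f_{i_t}(x_t)-f^*\bigr)$ with $f^*=\min_{i}\min_{x\in X_i}f_i(x)$. A function $g(P,t)$ is an *oracle lower bound* of $\mathcal F$ up to the horizon $T$ if for every base algorithm there is a problem $P\in\mathcal F$ such that $f(x_t)-\min_X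 f\ge g(P,t)$ for all $t=1,\dots,T$. Put $\underline g(t)=\inf_{P\in\mathcal F}g(P,t)$ and $G(m)=\sum_{s=1}^m\underline g(s)$. **Theorem.** (A) Let $T\ge 0$ and $K\ge1$, let $g$ be an oracle lower bound of $\mathcal F$ up to the horizon $T$, and let $g(\cdot,s)$ be bounded below on $\mathcal F$ for every $1\le s\le T$. Then for every FMAB algorithm with $K$ arms there is a family $P_1,\dots,P_K\in\mathcal F$ with $$R_O(T)\ \ge\ \inf_{k_i\in\mathbb Z_{\ge0},\ \sum_{i=1}^Kk_i=T}\ \sum_{i=1}^KG(k_i).$$ (B) Let $T,K\ge1$, let $g$ be an oracle lower bound of $\mathcal F$ up to the horizon $T$, and let $c>0$. In each of the following cases the bound on $\underline g(s)$ for all $1\le s\le T$ implies the bound on $G(m)$ for all $1\le m\le T$ and, for every FMAB algorithm with $K$ arms, the existence of a family in $\mathcal F$ with the stated regret: - ($M,R>0$) $\underline g(s)\ge cMR/\sqrt s$ implies $G(m)\ge cMR\sqrt m$ and $R_O(T)\ge cMR\sqrt T$; - ($L,R>0$) $\underline g(s)\ge cLR^2/s^2$ implies $G(m)\ge cLR^2$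 and $R_O(T)\ge cLR^2$; - ($\mu,M>0$) $\underline g(s)\ge cM^2/(\mu s)$ implies $G(m)\ge c\frac{M^2}{\mu}\log m$ and $R_O(T)\ge c\frac{M^2}{\mu}\log T$; - ($0<\mu\le L$, $R>0$, $\kappa=L/\mu$) $\underline g(s)\ge cR^2e^{-s/\sqrt\kappa}$ implies $G(m)\ge ce^{-1}R^2$ and $R_O(T)\ge ce^{-1}R^2$. (C) For the standard classes with a first-order oracle these orders hold unconditionally. For $\mu,L,M\ge0$ consider the problems in $\mathbb R^n$ for which $f:\mathbb R^n\to\mathbb R$ is convex, the oracle returns on $X$ the value $f(x)$ and a subgradient $f'(x)$, and for all $x,y\in X$ $$\tfrac{\mu}{2}\|x-y\|^2\le f(y)-f(x)-\langle f'(x),y-x\rangle\le\tfrac L2\|x-y\|^2+M\|x-y\|.$$ There is a universal constant $c>0$ such that for all $T,K\ge1$ and every FMAB algorithm with $K$ arms there is a family of $K$ problems in the class with - (i) $R_O(T)\ge cMR\sqrt T$ for the class of convex problems that are $M$-Lipschitz on $X$ ($\mu=L=0$, $M>0$) with $\operatorname{diam}X=R>0$, if $n\ge2T$; - (ii) $R_O(T)\ge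 cLR^2$ for the class of convex problems such that $f$ has an $L$-Lipschitz gradient on $\mathbb R^n$ ($\mu=M=0$, $L>0$) with $\operatorname{diam}X=R>0$, if $n\ge1$; - (iii) $R_O(T)\ge c\frac{M^2}{\mu}\log T$ for the class of $\mu$-strongly convex problems that are $M$-Lipschitz on $X$ ($L=0$, $\mu,M>0$), if $n\ge2T$; - (iv) $R_O(T)\ge cLR^2$, which is $\Omega(R^2)$ for fixed $\mu,L$, for the class of $\mu$-strongly convex problems such that $f$ has an $L$-Lipschitz gradient on $\mathbb R^n$ ($M=0$, $0<\mu\le L$) with $\operatorname{diam}X=R>0$, if $n\ge1$. -/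

import Mathlib

namespace FMAB

universe u

/-- `ℝⁿ` with the Euclidean norm. -/
abbrev E (n : ℕ) : Type := EuclideanSpace ℝ (Fin n)

/-- A decision set together with the dimension of the space in which it lies. -/
structure Domain where
  dim : ℕ
  carrier : Set (E dim)

/-- A convex optimization problem `min_{x ∈ X} f x` with an oracle. In dimension `n` the oracle
answers a query by an element of `Ω n`. The problem has a solution, so that the minimum exists. -/
structure Problem (Ω : ℕ → Type u) where
  dom : Domain
  f : E dom.dim → ℝ
  oracle : E dom.dim → Ω dom.dim
  convex_dom : Convex ℝ dom.carrier
  convex_f : ConvexOn ℝ dom.carrier f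
  exists_min : ∃ x ∈ dom.carrier, IsMinOn f dom.carrier x

/-- `min_{x ∈ X} f x` (attained, by `exists_min`). -/
noncomputable def Problem.minVal {Ω : ℕ → Type u} (P : Problem Ω) : ℝ :=
  sInf (P.f '' P.dom.carrier)

/-! ### Algorithms for a single problem -/

/-- A deterministic black-box algorithm: it knows the decision set and maps the past queries and
oracle answers (most recent first) to the next query. -/
def BaseAlg (Ω : ℕ → Type u) : Type u :=
  (D : Domain) → List (E D.dim × Ω D.dim) → E D.dim

namespace BaseAlg

variable {Ω : ℕ → Type u}

/-- Queries and answers of the first `t` steps, most recent first. -/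
def history (A : BaseAlg Ω) (P : Problem Ω) : ℕ → List (E P.dom.dim × Ω P.dom.dim)
  | 0 => []
  | t + 1 => (A P.dom (A.history P t), P.oracle (A P.dom (A.history P t))) :: A.history P t

/-- The query made after `t` completed steps: `A.query P t` is the point `x_{t+1}`. -/
def query (A : BaseAlg Ω) (P : Problem Ω) (t : ℕ) : E P.dom.dim :=
  A P.dom (A.history P t)

/-- On every problem of the class `F` all queries are feasible. -/
def Feasible (A : BaseAlg Ω) (F : Set (Problem Ω)) : Prop :=
  ∀ P ∈ F, ∀ t, A.query P t ∈ P.dom.carrier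

end BaseAlg

/-! ### Algorithms for the functional multi-armed bandit problem -/

/-- One round as the agent sees it: the index of the arm, the decision and the oracle answer. -/
abbrev Observation (Ω : ℕ → Type u) {K : ℕ} (D : Fin K → Domain) : Type u :=
  (i : Fin K) × (E (D i).dim × Ω (D i).dim)

/-- A deterministic FMAB algorithm: it knows the `K` decision sets and maps the past rounds (most
recent first) to an arm `i` and a point of the space of arm `i`. -/
def BanditAlg (Ω : ℕ → Type u) (K : ℕ) : Type u :=
  (D : Fin K → Domain) → List (Observation Ω D) → (i : Fin K) × E (D i).dim

namespace BanditAlg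

variable {Ω : ℕ → Type u} {K : ℕ}

/-- The decision sets of a family of problems. -/
abbrev doms (P : Fin K → Problem Ω) : Fin K → Domain := fun i => (P i).dom

/-- The oracle of the chosen arm is called at the chosen point. -/
def observe (P : Fin K → Problem Ω) (q : (i : Fin K) × E (doms P i).dim) :
    Observation Ω (doms P) :=
  ⟨q.1, (q.2, (P q.1).oracle q.2)⟩

/-- The first `t` rounds, most recent first. -/
def history (A : BanditAlg Ω K) (P : Fin K → Problem Ω) : ℕ → List (Observation Ω (doms P))
  | 0 => []
  | t + 1 => observe P (A (doms P) (A.history P t)) :: A.history P t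

/-- Arm and point chosen after `t` completed rounds, that is, in round `t + 1`. -/
def choice (A : BanditAlg Ω K) (P : Fin K → Problem Ω) (t : ℕ) : (i : Fin K) × E (P i).dom.dim :=
  A (doms P) (A.history P t)

/-- On every family of problems of the class `F` all decisions are feasible. -/
def Feasible (A : BanditAlg Ω K) (F : Set (Problem Ω)) : Prop :=
  ∀ P : Fin K → Problem Ω, (∀ i, P i ∈ F) →
    ∀ t, (A.choice P t).2 ∈ (P (A.choice P t).1).dom.carrier

/-- The cumulative regret `R_O(T) = ∑_{t=1}^T (f_{i_t}(x_t) - f^*)`, where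
`f^* = min_i min_{x ∈ X_i} f_i x`. -/
noncomputable def regret (A : BanditAlg Ω K) (P : Fin K → Problem Ω) (T : ℕ) : ℝ :=
  ∑ t ∈ Finset.range T, ((P (A.choice P t).1).f (A.choice P t).2 - ⨅ i, (P i).minVal)

end BanditAlg

/-- For every FMAB algorithm with `K` arms there is a family of `K` problems of the class `F` on
which its regret after `T` rounds is at least `b`. -/
def RegretAtLeast {Ω : ℕ → Type u} (F : Set (Problem Ω)) (K T : ℕ) (b : ℝ) : Prop :=
  ∀ A : BanditAlg Ω K, A.Feasible F →
    ∃ P : Fin K → Problem Ω, (∀ i, P i ∈ F) ∧ b ≤ A.regret P T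

/-! ### Oracle lower bounds of a class -/

/-- `g(H, t)` is a uniform lower bound of the class `F` up to the horizon `T`: for every algorithm
some problem `P` of the class has `f(x_t) - min f ≥ g(P, t)` for all `t = 1, …, T`. -/
def IsOracleLowerBound {Ω : ℕ → Type u} (F : Set (Problem Ω)) (g : Problem Ω → ℕ → ℝ) (T : ℕ) :
    Prop :=
  ∀ A : BaseAlg Ω, A.Feasible F →
    ∃ P ∈ F, ∀ t < T, g P (t + 1) ≤ P.f (A.query P t) - P.minVal

/-- The class-wide hardness `inf_H g(H, t)`. -/
noncomputable def hardness {Ω : ℕ → Type u} (F : Set (Problem Ω)) (g : Problem Ω → ℕ → ℝ)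
    (t : ℕ) : ℝ :=
  sInf ((fun P => g P t) '' F)

/-- `G(m) = ∑_{s=1}^m inf_H g(H, s)`. -/
noncomputable def cumHardness {Ω : ℕ → Type u} (F : Set (Problem Ω)) (g : Problem Ω → ℕ → ℝ)
    (m : ℕ) : ℝ :=
  ∑ s ∈ Finset.Icc 1 m, hardness F g s

/-! ### The standard classes with a first-order oracle -/

/-- The answers of a first-order oracle: a value and a (sub)gradient. -/
abbrev FirstOrder (n : ℕ) : Type := ℝ × E n

/-- The (sub)gradient `f'(x)` which the oracle returns. -/
def Problem.subgrad (P : Problem FirstOrder) (x : E P.dom.dim) : E P.dom.dim := (P.oracle x).2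

/-- `f : ℝⁿ → ℝ` is convex, the oracle returns its values and subgradients on `X`, and
`μ/2 ‖x - y‖² ≤ f y - f x - ⟨f' x, y - x⟩ ≤ L/2 ‖x - y‖² + M ‖x - y‖` on `X`. -/
structure InClass (μ L M : ℝ) (P : Problem FirstOrder) : Prop where
  convex : ConvexOn ℝ Set.univ P.f
  value : ∀ x ∈ P.dom.carrier, (P.oracle x).1 = P.f x
  isSubgrad : ∀ x ∈ P.dom.carrier, ∀ y, P.f x + inner ℝ (P.subgrad x) (y - x) ≤ P.f y
  lower : ∀ x ∈ P.dom.carrier, ∀ y ∈ P.dom.carrier,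
    μ / 2 * ‖x - y‖ ^ 2 ≤ P.f y - P.f x - inner ℝ (P.subgrad x) (y - x)
  upper : ∀ x ∈ P.dom.carrier, ∀ y ∈ P.dom.carrier,
    P.f y - P.f x - inner ℝ (P.subgrad x) (y - x) ≤ L / 2 * ‖x - y‖ ^ 2 + M * ‖x - y‖

/-- `f` is `M`-Lipschitz on the decision set. -/
def IsLip (M : ℝ) (P : Problem FirstOrder) : Prop :=
  ∀ x ∈ P.dom.carrier, ∀ y ∈ P.dom.carrier, |P.f x - P.f y| ≤ M * ‖x - y‖

/-- `f` is differentiable with `L`-Lipschitz gradient. -/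
def IsSmooth (L : ℝ) (P : Problem FirstOrder) : Prop :=
  Differentiable ℝ P.f ∧ ∀ x y, ‖gradient P.f x - gradient P.f y‖ ≤ L * ‖x - y‖

/-- The decision set has (finite) diameter `R`. -/
def HasDiam (R : ℝ) (P : Problem FirstOrder) : Prop :=
  Bornology.IsBounded P.dom.carrier ∧ Metric.diam P.dom.carrier = R

/-- Convex `M`-Lipschitz problems in `ℝⁿ`, decision set of diameter `R`. -/
def lipschitzClass (n : ℕ) (M R : ℝ) : Set (Problem FirstOrder) :=
  {P | P.dom.dim = n ∧ HasDiam R P ∧ InClass 0 0 M P ∧ IsLip M P}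

/-- Convex `L`-smooth problems in `ℝⁿ`, decision set of diameter `R`. -/
def smoothClass (n : ℕ) (L R : ℝ) : Set (Problem FirstOrder) :=
  {P | P.dom.dim = n ∧ HasDiam R P ∧ InClass 0 L 0 P ∧ IsSmooth L P}

/-- `μ`-strongly convex `M`-Lipschitz problems in `ℝⁿ`. -/
def strongLipschitzClass (n : ℕ) (μ M : ℝ) : Set (Problem FirstOrder) :=
  {P | P.dom.dim = n ∧ InClass μ 0 M P ∧ IsLip M P}

/-- `μ`-strongly convex `L`-smooth problems in `ℝⁿ`, decision set of diameter `R`. -/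
def strongSmoothClass (n : ℕ) (μ L R : ℝ) : Set (Problem FirstOrder) :=
  {P | P.dom.dim = n ∧ HasDiam R P ∧ InClass μ L 0 P ∧ IsSmooth L P}

end FMAB

/-! Identical arms already give the lower bound. On `K` copies of one problem `P`, the choice of arm
is irrelevant, `f^*` is the minimum of `P`, and the bandit algorithm simulates a base algorithm, so
an oracle lower bound applies to all `T` rounds at once. The regret is then at least `G(T)`, which
dominates the infimum over allocations because `(T, 0, …, 0)` is one of them
(`regretAtLeast_cumHardness`, `iInf_sum_cumHardness_le`). The orders in (B) are estimates of the sum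
`G(T)`.

For (C) it remains to find one hard problem against each base algorithm. In the smooth classes the
first query is fixed in advance, and the quadratic `L/2 ‖x - a‖²` with `a` far from it costs order
`LR²` in a single round.

In the Lipschitz classes a resisting oracle is built as a maximum of quadratic pieces along
orthonormal directions `u 0, u 1, …`. Direction `u i` is orthogonal to queries `0, …, i`, and piece
`i` is too small at the earlier queries to affect the answers there (`piece_anti`), so the
directions can be chosen one after another (`exists_resisting`). Query `t` then has value at least
`γ t`, while a combination of all the directions has value at most `b`; the parameters are tuned so
that the gaps `γ t - b` sum to order `MR√T` or `(M²/μ) log T`. -/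

namespace FMAB

/-! ### Reduction of bandit algorithms to base algorithms: all arms equal -/

section Reduction

variable {Ω : ℕ → Type*} {K : ℕ}

/-- The bandit rounds on `K` copies of one decision set, reconstructed from the queries and
answers. -/
def BanditAlg.lift (A : BanditAlg Ω K) (D : Domain) :
    List (E D.dim × Ω D.dim) → List (Observation Ω (fun _ : Fin K => D))
  | [] => []
  | q :: h => ⟨(A (fun _ => D) (A.lift D h)).1, q⟩ :: A.lift D h

/-- The base algorithm which runs a bandit algorithm on `K` copies of one problem. -/
def BanditAlg.toBase (A : BanditAlg Ω K) : BaseAlg Ω :=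
  fun D h => (A (fun _ => D) (A.lift D h)).2

/-- With equal arms, every arm index is recomputable from the preceding queries and answers, so the
single-problem transcript loses no information. -/
theorem BanditAlg.history_const (A : BanditAlg Ω K) (P : Problem Ω) (t : ℕ) :
    A.history (fun _ => P) t = A.lift P.dom (A.toBase.history P t) := by
  induction t with
  | zero => rfl
  | succ t ih =>
    change observe (fun _ => P) (A (doms fun _ => P) (A.history (fun _ => P) t)) ::
      A.history (fun _ => P) t = _
    rw [ih]
    rfl

theorem BanditAlg.choice_const (A : BanditAlg Ω K) (P : Problem Ω) (t : ℕ) :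
    (A.choice (fun _ => P) t).2 = A.toBase.query P t := by
  change (A (doms fun _ => P) (A.history (fun _ => P) t)).2 = _
  rw [A.history_const]
  rfl

theorem BanditAlg.Feasible.toBase {A : BanditAlg Ω K} {F : Set (Problem Ω)} (hA : A.Feasible F) :
    A.toBase.Feasible F := fun P hP t => by
  have h := hA (fun _ => P) (fun _ => hP) t
  rw [← A.choice_const]
  exact h

theorem BanditAlg.regret_const (A : BanditAlg Ω K) (hK : 0 < K) (P : Problem Ω) (T : ℕ) :
    A.regret (fun _ => P) T =
      ∑ t ∈ Finset.range T, (P.f (A.toBase.query P t) - P.minVal) := by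
  have : Nonempty (Fin K) := ⟨⟨0, hK⟩⟩
  refine Finset.sum_congr rfl fun t _ => ?_
  rw [ciInf_const, ← A.choice_const]

/-- A regret bound for a single arm holds for any number of arms. -/
theorem regretAtLeast_of_base {F : Set (Problem Ω)} {T : ℕ} {b : ℝ} (hK : 0 < K)
    (h : ∀ B : BaseAlg Ω, B.Feasible F →
      ∃ P ∈ F, b ≤ ∑ t ∈ Finset.range T, (P.f (B.query P t) - P.minVal)) :
    RegretAtLeast F K T b := fun A hA => by
  obtain ⟨P, hP, hb⟩ := h A.toBase hA.toBase
  exact ⟨fun _ => P, fun _ => hP, by rwa [A.regret_const hK]⟩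

theorem RegretAtLeast.mono {F : Set (Problem Ω)} {T : ℕ} {b b' : ℝ} (h : RegretAtLeast F K T b)
    (hb : b' ≤ b) : RegretAtLeast F K T b' := fun A hA => by
  obtain ⟨P, hP, hr⟩ := h A hA
  exact ⟨P, hP, hb.trans hr⟩

end Reduction

/-! ### The general lower bound -/

section General

variable {Ω : ℕ → Type*} {F : Set (Problem Ω)} {g : Problem Ω → ℕ → ℝ} {T K : ℕ}

theorem regretAtLeast_cumHardness (hK : 0 < K) (hg : IsOracleLowerBound F g T)
    (hb : ∀ s ∈ Finset.Icc 1 T, BddBelow ((fun P => g P s) '' F)) :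
    RegretAtLeast F K T (cumHardness F g T) := by
  refine regretAtLeast_of_base hK fun B hB => ?_
  obtain ⟨P, hP, hPg⟩ := hg B hB
  refine ⟨P, hP, ?_⟩
  rw [cumHardness, ← Finset.Ico_add_one_right_eq_Icc, Finset.sum_Ico_eq_sum_range,
    Nat.add_sub_cancel]
  refine Finset.sum_le_sum fun t ht => ?_
  rw [Finset.mem_range] at ht
  rw [add_comm 1 t]
  exact (csInf_le (hb (t + 1) (Finset.mem_Icc.2 ⟨by omega, ht⟩)) ⟨P, hP, rfl⟩).trans (hPg t ht)

/-- Allocate all `T` rounds to one arm; the other arms contribute the empty sum `G(0) = 0`. -/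
theorem iInf_sum_cumHardness_le (hK : 0 < K) :
    (⨅ k : {k : Fin K → ℕ // ∑ i, k i = T}, ∑ i, cumHardness F g (k.1 i)) ≤
      cumHardness F g T := by
  -- A real infimum is below its terms only when the family is bounded below; here there are
  -- finitely many allocations.
  have hfin : Finite {k : Fin K → ℕ // ∑ i, k i = T} := by
    have : {k : Fin K → ℕ | ∑ i, k i = T} ⊆ Set.Iic fun _ => T := fun k hk i => by
      rw [← show ∑ i, k i = T from hk]
      exact Finset.single_le_sum (fun _ _ => Nat.zero_le _) (Finset.mem_univ i)
    exact ((Set.finite_Iic _).subset this).to_subtype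
  refine (ciInf_le (Set.finite_range _).bddBelow
    ⟨Pi.single ⟨0, hK⟩ T, by simp⟩).trans (le_of_eq ?_)
  rw [Finset.sum_eq_single ⟨0, hK⟩]
  · simp
  · intro i _ hi
    simp [hi, cumHardness]
  · simp

/-- The real `sInf` of a set unbounded below is `0` by convention. A positive rate therefore
supplies the boundedness required by the general bound. -/
theorem bddBelow_of_hardness_pos {s : ℕ} (h : 0 < hardness F g s) :
    BddBelow ((fun P => g P s) '' F) := by
  by_contra hb
  rw [hardness, Real.sInf_of_not_bddBelow hb] at h
  exact h.false

/-- A positive lower bound on the hardness yields bounds on its sums and on the regret. -/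
theorem rate_of_hardness (hT : 0 < T) (hK : 0 < K) (hg : IsOracleLowerBound F g T)
    {a b : ℕ → ℝ} (ha : ∀ s ∈ Finset.Icc 1 T, 0 < a s)
    (hh : ∀ s ∈ Finset.Icc 1 T, a s ≤ hardness F g s)
    (hab : ∀ m ∈ Finset.Icc 1 T, b m ≤ ∑ s ∈ Finset.Icc 1 m, a s) :
    (∀ m ∈ Finset.Icc 1 T, b m ≤ cumHardness F g m) ∧ RegretAtLeast F K T (b T) := by
  have hG : ∀ m ∈ Finset.Icc 1 T, b m ≤ cumHardness F g m := fun m hm =>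
    (hab m hm).trans <| Finset.sum_le_sum fun s hs => hh s <|
      Finset.Icc_subset_Icc_right (Finset.mem_Icc.1 hm).2 hs
  refine ⟨hG, (regretAtLeast_cumHardness hK hg fun s hs => ?_).mono
    (hG T (Finset.mem_Icc.2 ⟨hT, le_rfl⟩))⟩
  exact bddBelow_of_hardness_pos ((ha s hs).trans_le (hh s hs))

end General

/-! ### Elementary sums -/

/-- Each of the `m` terms is at least the last one, `1 / √m`. -/
theorem sqrt_le_sum_inv_sqrt (m : ℕ) :
    √(m : ℝ) ≤ ∑ s ∈ Finset.Icc 1 m, 1 / √(s : ℝ) := by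
  have h : ∑ _s ∈ Finset.Icc 1 m, 1 / √(m : ℝ) ≤ ∑ s ∈ Finset.Icc 1 m, 1 / √(s : ℝ) := by
    refine Finset.sum_le_sum fun s hs => ?_
    rw [Finset.mem_Icc] at hs
    have : (1 : ℝ) ≤ s := by exact_mod_cast hs.1
    gcongr
    exact hs.2
  refine le_trans (le_of_eq ?_) h
  simp only [Finset.sum_const, Nat.card_Icc, Nat.add_sub_cancel, nsmul_eq_mul, mul_one_div,
    Real.div_sqrt]

theorem log_le_sum_inv (m : ℕ) :
    Real.log m ≤ ∑ s ∈ Finset.Icc 1 m, 1 / (s : ℝ) := by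
  have h := log_le_harmonic_floor (m : ℝ) (Nat.cast_nonneg m)
  rw [Nat.floor_natCast, harmonic_eq_sum_Icc] at h
  simpa using h

theorem first_le_sum {a : ℕ → ℝ} {m : ℕ} (hm : 1 ≤ m) (ha : ∀ s, 1 ≤ s → 0 ≤ a s) :
    a 1 ≤ ∑ s ∈ Finset.Icc 1 m, a s :=
  Finset.single_le_sum (fun s hs => ha s (Finset.mem_Icc.1 hs).1)
    (Finset.mem_Icc.2 ⟨le_rfl, hm⟩)

/-! ### Strongly convex functions given with subgradients -/

/-- `s x` is a subgradient of the `μ`-strongly convex function `f` at every point `x`. -/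
def StrongSubgrad {n : ℕ} (μ : ℝ) (f : E n → ℝ) (s : E n → E n) : Prop :=
  ∀ x y, f x + inner ℝ (s x) (y - x) + μ / 2 * ‖x - y‖ ^ 2 ≤ f y

section Subgradient

variable {n : ℕ} {μ C : ℝ} {f φ : E n → ℝ} {s ψ : E n → E n}

theorem StrongSubgrad.le (h : StrongSubgrad μ f s) (hμ : 0 ≤ μ) (x y : E n) :
    f x + inner ℝ (s x) (y - x) ≤ f y := by
  have : 0 ≤ μ / 2 * ‖x - y‖ ^ 2 := by positivity
  linarith [h x y]

/-- Average the subgradient inequalities based at `a • x + b • y`; the linear terms cancel. -/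
theorem StrongSubgrad.convexOn (h : StrongSubgrad μ f s) (hμ : 0 ≤ μ) :
    ConvexOn ℝ Set.univ f := by
  refine ⟨convex_univ, fun x _ y _ a b ha hb hab => ?_⟩
  have hx := mul_le_mul_of_nonneg_left (h.le hμ (a • x + b • y) x) ha
  have hy := mul_le_mul_of_nonneg_left (h.le hμ (a • x + b • y) y) hb
  have h0 : a • (x - (a • x + b • y)) + b • (y - (a • x + b • y)) = 0 := by
    obtain rfl : a = 1 - b := by linarith
    module
  have hi := congrArg (fun z => inner ℝ (s (a • x + b • y)) z) h0
  simp only [inner_add_right, real_inner_smul_right, inner_zero_right] at hi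
  simp only [smul_eq_mul]
  have : f (a • x + b • y) = a * f (a • x + b • y) + b * f (a • x + b • y) := by
    rw [← add_mul, hab, one_mul]
  simp only [inner_sub_right, inner_add_right, real_inner_smul_right] at hx hy hi
  linarith

theorem StrongSubgrad.abs_sub_le (h : StrongSubgrad μ f s) (hμ : 0 ≤ μ) {x y : E n}
    (hx : ‖s x‖ ≤ C) (hy : ‖s y‖ ≤ C) : |f x - f y| ≤ C * ‖x - y‖ := by
  have key : ∀ x y : E n, ‖s x‖ ≤ C → f x - f y ≤ C * ‖x - y‖ := fun x y hx => by
    have h1 := h.le hμ x y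
    have h2 := real_inner_le_norm (s x) (x - y)
    have h3 : ‖s x‖ * ‖x - y‖ ≤ C * ‖x - y‖ := by gcongr
    rw [← neg_sub x y, inner_neg_right] at h1
    linarith
  rw [abs_sub_le_iff]
  exact ⟨key x y hx, by rw [norm_sub_rev]; exact key y x hy⟩

theorem StrongSubgrad.max (hf : StrongSubgrad μ f s) (hφ : StrongSubgrad μ φ ψ) :
    StrongSubgrad μ (fun x => Max.max (f x) (φ x))
      (fun x => if φ x ≤ f x then s x else ψ x) := fun x y => by
  dsimp only
  split_ifs with h
  · rw [max_eq_left h]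
    exact (hf x y).trans (le_max_left _ _)
  · rw [max_eq_right (not_le.1 h).le]
    exact (hφ x y).trans (le_max_right _ _)

/-- Equality holds: the second-order expansion of the quadratic is exact. -/
theorem strongSubgrad_quadratic (μ γ : ℝ) (p v : E n) :
    StrongSubgrad μ (fun x => μ / 2 * ‖x - p‖ ^ 2 - inner ℝ v x + γ)
      (fun x => μ • (x - p) - v) := fun x y => by
  have hy : y - p = (x - p) + (y - x) := by abel
  have hv : inner ℝ v y = inner ℝ v x + inner ℝ v (y - x) := by
    rw [← inner_add_right, add_sub_cancel]
  dsimp only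
  rw [hy, norm_add_sq_real, hv, inner_sub_left, real_inner_smul_left, norm_sub_rev x y]
  apply le_of_eq
  ring

/-- The problem on a ball given by a function with bounded subgradients. -/
noncomputable def ballProblem (n : ℕ) (r : ℝ) (hr : 0 ≤ r) (f : E n → ℝ) (s : E n → E n)
    (μ C : ℝ) (hμ : 0 ≤ μ) (h : StrongSubgrad μ f s)
    (hs : ∀ x ∈ Metric.closedBall (0 : E n) r, ‖s x‖ ≤ C) : Problem FirstOrder where
  dom := ⟨n, Metric.closedBall 0 r⟩
  f := f
  oracle := fun x => (f x, s x)
  convex_dom := convex_closedBall 0 r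
  convex_f := (h.convexOn hμ).subset (Set.subset_univ _) (convex_closedBall 0 r)
  exists_min := by
    refine (isCompact_closedBall (0 : E n) r).exists_isMinOn ⟨0, by simpa using hr⟩ ?_
    have hC : 0 ≤ C := (norm_nonneg _).trans (hs 0 (by simpa using hr))
    refine (LipschitzOnWith.of_dist_le_mul (K := ⟨C, hC⟩) fun x hx y hy => ?_).continuousOn
    rw [Real.dist_eq, dist_eq_norm]
    exact h.abs_sub_le hμ (hs x hx) (hs y hy)

/-- In the upper bound, the increment of `f` and the linear term each contribute at most `C * ‖x -
y‖`, hence `2 * C`. -/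
theorem ballProblem_inClass {r : ℝ} (hr : 0 ≤ r) (hμ : 0 ≤ μ) (h : StrongSubgrad μ f s)
    (hs : ∀ x ∈ Metric.closedBall (0 : E n) r, ‖s x‖ ≤ C) :
    InClass μ 0 (2 * C) (ballProblem n r hr f s μ C hμ h hs) where
  convex := h.convexOn hμ
  value _ _ := rfl
  isSubgrad x _ y := h.le hμ x y
  lower := fun (x : E n) _ (y : E n) _ => by
    have := h x y
    have h' : μ / 2 * ‖x - y‖ ^ 2 ≤ f y - f x - inner ℝ (s x) (y - x) := by linarith
    exact h'
  upper := fun (x : E n) hx (y : E n) hy => by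
    have h1 := (abs_sub_le_iff.1 (h.abs_sub_le hμ (hs x hx) (hs y hy))).2
    have h2 := real_inner_le_norm (s x) (x - y)
    have h3 : ‖s x‖ * ‖x - y‖ ≤ C * ‖x - y‖ := by
      gcongr
      exact hs x hx
    have h4 : f y - f x - inner ℝ (s x) (y - x) ≤
        0 / 2 * ‖x - y‖ ^ 2 + 2 * C * ‖x - y‖ := by
      rw [← neg_sub x y, inner_neg_right]
      linarith
    exact h4

theorem ballProblem_isLip {r : ℝ} (hr : 0 ≤ r) (hμ : 0 ≤ μ) (h : StrongSubgrad μ f s)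
    (hs : ∀ x ∈ Metric.closedBall (0 : E n) r, ‖s x‖ ≤ C) :
    IsLip (2 * C) (ballProblem n r hr f s μ C hμ h hs) := fun (x : E n) hx (y : E n) hy => by
  have hC : 0 ≤ C := (norm_nonneg _).trans (hs x hx)
  refine (h.abs_sub_le hμ (hs x hx) (hs y hy)).trans ?_
  have := mul_nonneg hC (norm_nonneg (x - y))
  change C * ‖x - y‖ ≤ 2 * C * ‖x - y‖
  linarith

end Subgradient

theorem Problem.minVal_le {Ω : ℕ → Type*} (P : Problem Ω) {x : E P.dom.dim}
    (hx : x ∈ P.dom.carrier) : P.minVal ≤ P.f x := by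
  obtain ⟨z, -, hz⟩ := P.exists_min
  refine csInf_le ⟨P.f z, ?_⟩ ⟨x, hx, rfl⟩
  rintro _ ⟨y, hy, rfl⟩
  exact hz hy

theorem diam_closedBall_half {n : ℕ} (hn : 0 < n) {R : ℝ} (hR : 0 ≤ R) :
    Metric.diam (Metric.closedBall (0 : E n) (R / 2)) = R := by
  have : Nonempty (Fin n) := ⟨⟨0, hn⟩⟩
  have : Nontrivial (E n) := inferInstance
  rw [Metric.diam_closedBall_eq _ (by positivity)]
  ring

/-! ### Smooth problems -/

/-- For `L/2 ‖x - a‖²` the linearization error is exactly `L/2 ‖x - y‖²`, so the problem lies in the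
class for every `μ ≤ L`, including `μ = 0`. -/
theorem regretAtLeast_strongSmoothClass {μ L R : ℝ} {T n K : ℕ} (hμL : μ ≤ L) (hL : 0 < L)
    (hR : 0 < R) (hT : 0 < T) (hn : 0 < n) (hK : 0 < K) :
    RegretAtLeast (strongSmoothClass n μ L R) K T (1 / 8 * (L * R ^ 2)) := by
  refine regretAtLeast_of_base hK fun B _ => ?_
  let D : Domain := ⟨n, Metric.closedBall 0 (R / 2)⟩
  let x₁ : E n := B D []
  -- The first query precedes any answer, so `a` may depend on it. Antipodal boundary points are `R`
  -- apart, so one of them is at distance at least `R / 2` from `x₁`.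
  obtain ⟨a, ha, hax⟩ : ∃ a : E n, ‖a‖ ≤ R / 2 ∧ R / 2 ≤ ‖x₁ - a‖ := by
    let e : E n := EuclideanSpace.single ⟨0, hn⟩ (R / 2)
    have he : ‖e‖ = R / 2 := by
      rw [PiLp.norm_single, Real.norm_of_nonneg (by positivity)]
    by_cases h : R / 2 ≤ ‖x₁ - e‖
    · exact ⟨e, he.le, h⟩
    · refine ⟨-e, by rw [norm_neg, he], ?_⟩
      have h2 : ‖(x₁ - -e) - (x₁ - e)‖ = R := by
        rw [show (x₁ - -e) - (x₁ - e) = (2 : ℝ) • e by module, norm_smul, he,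
          Real.norm_two]
        ring
      linarith [norm_sub_le (x₁ - -e) (x₁ - e)]
  have hq : StrongSubgrad L (fun x : E n => L / 2 * ‖x - a‖ ^ 2) (fun x => L • (x - a)) := by
    simpa using strongSubgrad_quadratic L 0 a 0
  have heq : ∀ x y : E n, L / 2 * ‖y - a‖ ^ 2 - L / 2 * ‖x - a‖ ^ 2
      - inner ℝ (L • (x - a)) (y - x) = L / 2 * ‖x - y‖ ^ 2 := fun x y => by
    rw [show y - a = (x - a) + (y - x) by abel, norm_add_sq_real, real_inner_smul_left,
      norm_sub_rev x y]
    ring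
  have hgrad : ∀ x : E n, HasGradientAt (fun x : E n => L / 2 * ‖x - a‖ ^ 2) (L • (x - a)) x :=
    fun x => by
      rw [hasGradientAt_iff_hasFDerivAt]
      have h := (((hasFDerivAt_id x).sub_const a).norm_sq).const_mul (L / 2)
      refine h.congr_fderiv ?_
      ext y
      simp
      ring
  let P : Problem FirstOrder := ballProblem n (R / 2) (by positivity) _ _ L (L * R) hL.le hq
    fun x hx => by
      rw [mem_closedBall_zero_iff] at hx
      rw [norm_smul, Real.norm_of_nonneg hL.le]
      gcongr
      linarith [norm_sub_le x a]
  refine ⟨P, ⟨rfl, ⟨Metric.isBounded_closedBall, diam_closedBall_half hn hR.le⟩,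
    ⟨hq.convexOn hL.le, fun _ _ => rfl, fun x _ y => hq.le hL.le x y, fun (x : E n) _ (y : E n) _ => ?_,
      fun (x : E n) _ (y : E n) _ => ?_⟩, fun x => (hgrad x).differentiableAt,
      fun (x : E n) (y : E n) => ?_⟩, ?_⟩
  · have h : μ / 2 * ‖x - y‖ ^ 2 ≤ L / 2 * ‖x - y‖ ^ 2 := by gcongr
    exact h.trans_eq (heq x y).symm
  · have h : L / 2 * ‖x - y‖ ^ 2 ≤ L / 2 * ‖x - y‖ ^ 2 + 0 * ‖x - y‖ := by simp
    exact (heq x y).le.trans h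
  · have h : ‖gradient (fun x : E n => L / 2 * ‖x - a‖ ^ 2) x -
        gradient (fun x : E n => L / 2 * ‖x - a‖ ^ 2) y‖ ≤ L * ‖x - y‖ := by
      rw [(hgrad x).gradient, (hgrad y).gradient, ← smul_sub, norm_smul,
        Real.norm_of_nonneg hL.le, sub_sub_sub_cancel_right]
    exact h
  · have hmin : P.minVal ≤ 0 := by
      refine (P.minVal_le (x := a) (mem_closedBall_zero_iff.2 ha)).trans (le_of_eq ?_)
      change L / 2 * ‖a - a‖ ^ 2 = 0
      simp
    have hnonneg : ∀ x, 0 ≤ P.f x := fun x => by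
      change 0 ≤ L / 2 * ‖(show E n from x) - a‖ ^ 2
      positivity
    -- All gaps are nonnegative; the first alone is at least `L/2 (R/2)² = LR²/8`.
    refine le_trans ?_ (Finset.single_le_sum
      (fun t _ => sub_nonneg.2 (hmin.trans (hnonneg (B.query P t)))) (Finset.mem_range.2 hT))
    have h1 : P.f (B.query P 0) = L / 2 * ‖x₁ - a‖ ^ 2 := rfl
    rw [h1]
    have h2 : L / 2 * (R / 2) ^ 2 ≤ L / 2 * ‖x₁ - a‖ ^ 2 := by gcongr
    linarith

theorem strongSmoothClass_zero (n : ℕ) (L R : ℝ) :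
    strongSmoothClass n 0 L R = smoothClass n L R := rfl

/-! ### The resisting oracle -/

/-- Queries and answers of the first `t` steps of an algorithm `a` against an oracle `o`, most
recent first. -/
def run {α β : Type*} (a : List (α × β) → α) (o : α → β) : ℕ → List (α × β)
  | 0 => []
  | t + 1 => (a (run a o t), o (a (run a o t))) :: run a o t

/-- An algorithm sees an oracle only at its own queries, so agreement there preserves the transcript
and hence also the next query. -/
theorem run_congr {α β : Type*} (a : List (α × β) → α) {o o' : α → β} {k : ℕ}
    (h : ∀ t < k, o' (a (run a o t)) = o (a (run a o t))) {t : ℕ} (ht : t ≤ k) :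
    run a o' t = run a o t := by
  induction t with
  | zero => rfl
  | succ t ih => rw [run, run, ih (by omega), h t ht]

theorem BaseAlg.history_eq_run {Ω : ℕ → Type*} (B : BaseAlg Ω) (P : Problem Ω) (t : ℕ) :
    B.history P t = run (B P.dom) P.oracle t := by
  induction t with
  | zero => rfl
  | succ t ih => rw [BaseAlg.history, run, ih]

theorem exists_unit_orthogonal {n k : ℕ} (hk : k < n) (v : Fin k → E n) :
    ∃ e : E n, ‖e‖ = 1 ∧ ∀ i, inner ℝ e (v i) = 0 := by
  have hlt : Submodule.span ℝ (Set.range v) ≠ ⊤ := fun h => by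
    have h1 := finrank_range_le_card (R := ℝ) v
    rw [Set.finrank, h, finrank_top, finrank_euclideanSpace_fin, Fintype.card_fin] at h1
    omega
  have hbot : (Submodule.span ℝ (Set.range v))ᗮ ≠ ⊥ := fun h =>
    hlt (Submodule.orthogonal_eq_bot_iff.1 h)
  obtain ⟨z, hz, hz0⟩ := Submodule.exists_mem_ne_zero_of_ne_bot hbot
  refine ⟨‖z‖⁻¹ • z, ?_, fun i => ?_⟩
  · rw [norm_smul, norm_inv, norm_norm, inv_mul_cancel₀ (norm_ne_zero_iff.2 hz0)]
  · rw [real_inner_smul_left, Submodule.inner_left_of_mem_orthogonal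
      (Submodule.subset_span (Set.mem_range_self i)) hz, mul_zero]

/-- The first `k` vectors of the sequence are orthonormal. -/
def OrthonormalUpTo {n : ℕ} (k : ℕ) (u : ℕ → E n) : Prop :=
  ∀ i < k, ∀ j < k, inner ℝ (u i) (u j) = if i = j then (1 : ℝ) else 0

section Model

variable {n : ℕ} (μ M β : ℝ) (w γ : ℕ → ℝ) (u v : ℕ → E n)

/-- The center of the piece `k`. -/
noncomputable def center (k : ℕ) : E n := ∑ i ∈ Finset.range k, w i • u i

/-- The quadratic piece `k`. -/
noncomputable def piece (k : ℕ) (x : E n) : ℝ :=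
  μ / 2 * ‖x - center w u k‖ ^ 2 - inner ℝ (M • u k) x + γ k

/-- The gradient of the piece `k`. -/
noncomputable def pieceGrad (k : ℕ) (x : E n) : E n := μ • (x - center w u k) - M • u k

/-- The maximum of a basic quadratic and of the first `k` pieces, with its subgradients. Ties are
resolved in favour of the earlier piece. -/
noncomputable def model : ℕ → (E n → ℝ) × (E n → E n)
  | 0 => (fun x => μ / 2 * ‖x‖ ^ 2 - β, fun x => μ • x)
  | k + 1 => (fun x => max ((model k).1 x) (piece μ M w γ u k x),
      fun x => if piece μ M w γ u k x ≤ (model k).1 x then (model k).2 x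
        else pieceGrad μ M w u k x)

/-- The oracle of the model with `k` pieces. -/
noncomputable def modelOracle (k : ℕ) (x : E n) : ℝ × E n :=
  ((model μ M β w γ u k).1 x, (model μ M β w γ u k).2 x)

variable {μ M β w γ u v}

theorem center_congr {k : ℕ} (h : ∀ i < k, u i = v i) : center w u k = center w v k :=
  Finset.sum_congr rfl fun i hi => by rw [h i (Finset.mem_range.1 hi)]

theorem model_congr {k : ℕ} (h : ∀ i < k, u i = v i) :
    model μ M β w γ u k = model μ M β w γ v k := by
  induction k with
  | zero => rfl
  | succ k ih =>
    have hk := ih fun i hi => h i (by omega)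
    have hc : center w u k = center w v k := center_congr fun i hi => h i (by omega)
    have hp : piece μ M w γ u k = piece μ M w γ v k := by
      funext x
      rw [piece, piece, hc, h k (by omega)]
    have hg : pieceGrad μ M w u k = pieceGrad μ M w v k := by
      funext x
      rw [pieceGrad, pieceGrad, hc, h k (by omega)]
    rw [model, model, hk, hp, hg]

theorem strongSubgrad_model (k : ℕ) :
    StrongSubgrad μ (model μ M β w γ u k).1 (model μ M β w γ u k).2 := by
  induction k with
  | zero => simpa [model, sub_eq_add_neg] using strongSubgrad_quadratic μ (-β) (0 : E n) 0
  | succ k ih => exact ih.max (strongSubgrad_quadratic μ (γ k) (center w u k) (M • u k))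

theorem piece_le_model {t k : ℕ} (h : t < k) (x : E n) :
    piece μ M w γ u t x ≤ (model μ M β w γ u k).1 x := by
  induction k with
  | zero => omega
  | succ k ih =>
    rcases Nat.lt_succ_iff_lt_or_eq.1 h with h | rfl
    · exact (ih h).trans (le_max_left _ _)
    · exact le_max_right _ _

theorem model_le {k : ℕ} {x : E n} {b : ℝ} (h0 : μ / 2 * ‖x‖ ^ 2 - β ≤ b)
    (h : ∀ t < k, piece μ M w γ u t x ≤ b) : (model μ M β w γ u k).1 x ≤ b := by
  induction k with
  | zero => exact h0
  | succ k ih => exact max_le (ih fun t ht => h t (by omega)) (h k (by omega))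

theorem norm_model_le {k : ℕ} {x : E n} {C : ℝ} (h0 : ‖μ • x‖ ≤ C)
    (h : ∀ t < k, ‖pieceGrad μ M w u t x‖ ≤ C) : ‖(model μ M β w γ u k).2 x‖ ≤ C := by
  induction k with
  | zero => exact h0
  | succ k ih =>
    rw [model]
    dsimp only
    split_ifs
    · exact ih fun t ht => h t (by omega)
    · exact h k (by omega)

/-- The tie rule matters here: a new piece that at most equals the old maximum changes neither the
value nor the returned subgradient. -/
theorem modelOracle_succ {k : ℕ} {x : E n}
    (h : piece μ M w γ u k x ≤ (model μ M β w γ u k).1 x) :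
    modelOracle μ M β w γ u (k + 1) x = modelOracle μ M β w γ u k x := by
  simp only [modelOracle, model, max_eq_left h, if_pos h]

theorem inner_center_eq_zero {k : ℕ} {z : E n} (h : ∀ i < k, inner ℝ (u i) z = 0) :
    inner ℝ (center w u k) z = 0 := by
  rw [center, sum_inner]
  refine Finset.sum_eq_zero fun i hi => ?_
  rw [real_inner_smul_left, h i (Finset.mem_range.1 hi), mul_zero]

/-- A point orthogonal to the vectors number `t, …, k` does not see the piece `k` behind the
piece `t`. -/
theorem piece_anti {t k T : ℕ} (hu : OrthonormalUpTo T u)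
    (hγ : ∀ i, μ / 2 * w i ^ 2 ≤ γ i - γ (i + 1)) (htk : t ≤ k) (hk : k < T) {x : E n}
    (hx : ∀ i, t ≤ i → i ≤ k → inner ℝ (u i) x = 0) :
    piece μ M w γ u k x ≤ piece μ M w γ u t x := by
  induction k, htk using Nat.le_induction with
  | base => exact le_rfl
  | succ k htk ih =>
    refine le_trans ?_ (ih (by omega) fun i h1 h2 => hx i h1 (by omega))
    have h1 := hx k htk (by omega)
    have h2 := hx (k + 1) (by omega) le_rfl
    -- Since `x - center w u k` is orthogonal to `u k`, the shift of the center adds exactly `w k ^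
    -- 2` to the squared distance; the drop from `γ k` to `γ (k + 1)` compensates for it.
    have h3 : inner ℝ (x - center w u k) (u k) = 0 := by
      rw [inner_sub_left, real_inner_comm, h1, inner_center_eq_zero fun i hi => ?_, sub_zero]
      rw [hu i (by omega) k (by omega), if_neg (by omega)]
    have h4 : ‖u k‖ ^ 2 = 1 := by
      rw [← real_inner_self_eq_norm_sq, hu k (by omega) k (by omega), if_pos rfl]
    have h5 : x - center w u (k + 1) = (x - center w u k) - w k • u k := by
      rw [center, Finset.sum_range_succ, ← center, sub_sub]
    rw [piece, piece, real_inner_smul_left, real_inner_smul_left, h1, h2, h5, norm_sub_sq_real,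
      real_inner_smul_right, h3, norm_smul, mul_pow, h4, Real.norm_eq_abs, sq_abs]
    linarith [hγ k]

theorem piece_of_orthogonal {t : ℕ} (hμ : 0 ≤ μ) {x : E n} (hx : inner ℝ (u t) x = 0) :
    γ t ≤ piece μ M w γ u t x := by
  rw [piece, real_inner_smul_left, hx]
  have : 0 ≤ μ / 2 * ‖x - center w u t‖ ^ 2 := by positivity
  linarith

theorem inner_center {k t : ℕ} (hu : OrthonormalUpTo k u) (ht : t < k) :
    inner ℝ (u t) (center w u k) = w t := by
  rw [center, inner_sum, Finset.sum_eq_single t]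
  · rw [real_inner_smul_right, hu t ht t ht, if_pos rfl, mul_one]
  · intro j hj hij
    rw [real_inner_smul_right, hu t ht j (Finset.mem_range.1 hj), if_neg hij.symm, mul_zero]
  · exact fun h => absurd (Finset.mem_range.2 ht) h

theorem inner_center_center {k t : ℕ} (hu : OrthonormalUpTo k u) (ht : t ≤ k) :
    inner ℝ (center w u t) (center w u k) = ∑ i ∈ Finset.range t, w i ^ 2 := by
  rw [center, sum_inner]
  refine Finset.sum_congr rfl fun i hi => ?_
  rw [real_inner_smul_left, inner_center hu ((Finset.mem_range.1 hi).trans_le ht), sq]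

theorem norm_sq_center {k : ℕ} (hu : OrthonormalUpTo k u) :
    ‖center w u k‖ ^ 2 = ∑ i ∈ Finset.range k, w i ^ 2 := by
  rw [← real_inner_self_eq_norm_sq, inner_center_center hu le_rfl]

theorem OrthonormalUpTo.mono {k l : ℕ} (hu : OrthonormalUpTo k u) (h : l ≤ k) :
    OrthonormalUpTo l u := fun i hi j hj => hu i (by omega) j (by omega)

theorem norm_sq_center_sub_center {k t : ℕ} (hu : OrthonormalUpTo k u) (ht : t ≤ k) :
    ‖center w u k - center w u t‖ ^ 2 = ∑ i ∈ Finset.Ico t k, w i ^ 2 := by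
  rw [norm_sub_sq_real, real_inner_comm, inner_center_center hu ht, norm_sq_center hu,
    norm_sq_center (hu.mono ht), Finset.sum_Ico_eq_sub _ ht]
  ring

/-- For every algorithm the model can be chosen such that the query number `t` is orthogonal to
the vectors number `t, t + 1, …`. -/
theorem exists_resisting (hγ : ∀ i, μ / 2 * w i ^ 2 ≤ γ i - γ (i + 1)) {T : ℕ} (hn : 2 * T ≤ n)
    (a : List (E n × (ℝ × E n)) → E n) {k : ℕ} (hk : k ≤ T) :
    ∃ u : ℕ → E n, OrthonormalUpTo k u ∧ ∀ t i, t ≤ i → i < k →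
      inner ℝ (u i) (a (run a (modelOracle μ M β w γ u k) t)) = 0 := by
  induction k with
  | zero => exact ⟨fun _ => 0, fun i hi => by omega, fun t i _ hi => by omega⟩
  | succ k ih =>
    obtain ⟨u, hu, hux⟩ := ih (by omega)
    let q : ℕ → E n := fun t => a (run a (modelOracle μ M β w γ u k) t)
    -- The new direction avoids `k` old directions and the `k + 1` queries made so far, including
    -- query `k`, which depends on `k` answers only. Since `k < T`, there are `2k + 1 < 2T ≤ n`
    -- constraints.
    obtain ⟨e, he, heq⟩ := exists_unit_orthogonal (n := n) (k := k + (k + 1)) (by omega)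
      (Fin.append (fun i : Fin k => u i) fun t : Fin (k + 1) => q t)
    have heu : ∀ i < k, inner ℝ e (u i) = 0 := fun i hi => by
      have := heq (Fin.castAdd (k + 1) ⟨i, hi⟩)
      rwa [Fin.append_left] at this
    have hex : ∀ t ≤ k, inner ℝ e (q t) = 0 := fun t ht => by
      have := heq (Fin.natAdd k ⟨t, by omega⟩)
      rwa [Fin.append_right] at this
    let v : ℕ → E n := Function.update u k e
    have hvk : v k = e := Function.update_self ..
    have hvu : ∀ i < k, v i = u i := fun i hi => Function.update_of_ne (by omega) ..
    have hv : OrthonormalUpTo (k + 1) v := fun i hi j hj => by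
      rcases Nat.lt_succ_iff_lt_or_eq.1 hi with hi | rfl <;>
        rcases Nat.lt_succ_iff_lt_or_eq.1 hj with hj | rfl
      · rw [hvu i hi, hvu j hj, hu i hi j hj]
      · rw [hvu i hi, hvk, real_inner_comm, heu i hi, if_neg (by omega)]
      · rw [hvu j hj, hvk, heu j hj, if_neg (by omega)]
      · rw [hvk, real_inner_self_eq_norm_sq, he, if_pos rfl, one_pow]
    have hvq : ∀ t i, t ≤ i → i ≤ k → inner ℝ (v i) (q t) = 0 := fun t i hti hi => by
      rcases hi.lt_or_eq with hi | rfl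
      · rw [hvu i hi]
        exact hux t i hti hi
      · rw [hvk]
        exact hex t hti
    have hmodel : model μ M β w γ v k = model μ M β w γ u k := model_congr hvu
    -- At query `t < k` the new piece is below piece `t`, which is already in the maximum. The
    -- answers, and hence queries `0, …, k`, stay unchanged.
    have horacle : ∀ t < k, modelOracle μ M β w γ v (k + 1) (q t) =
        modelOracle μ M β w γ u k (q t) := fun t ht => by
      rw [modelOracle_succ, modelOracle, hmodel, modelOracle]
      exact (piece_anti hv hγ ht.le (by omega) fun i h1 h2 => hvq t i h1 h2).trans
        (piece_le_model ht _)
    refine ⟨v, hv, fun t i hti hi => ?_⟩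
    rw [run_congr a horacle (by omega)]
    exact hvq t i hti (by omega)

end Model

/-- The resisting problem on a ball. -/
theorem exists_resisting_problem {n T : ℕ} {μ M r β b : ℝ} {w γ α : ℕ → ℝ} (hμ : 0 ≤ μ)
    (hM : 0 ≤ M) (hr : 0 ≤ r) (hγ : ∀ i, μ / 2 * w i ^ 2 ≤ γ i - γ (i + 1)) (hn : 2 * T ≤ n)
    (hμr : μ * r ≤ M) (hw : μ ^ 2 * ∑ i ∈ Finset.range T, w i ^ 2 ≤ M ^ 2)
    (hα : ∑ i ∈ Finset.range T, α i ^ 2 ≤ r ^ 2)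
    (hb : ∀ u : ℕ → E n, OrthonormalUpTo T u →
      (model μ M β w γ u T).1 (center α u T) ≤ b)
    (B : BaseAlg FirstOrder) :
    ∃ P : Problem FirstOrder, P.dom = ⟨n, Metric.closedBall 0 r⟩ ∧ InClass μ 0 (6 * M) P ∧
      IsLip (6 * M) P ∧ ∀ t < T, γ t - b ≤ P.f (B.query P t) - P.minVal := by
  obtain ⟨u, hu, hux⟩ := exists_resisting (M := M) (β := β) hγ hn
    (B ⟨n, Metric.closedBall 0 r⟩) le_rfl
  -- A piece has gradient `μ x - μ c - M u`, each of whose three terms has norm at most `M` on the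
  -- ball; `6 * M` is twice this bound.
  have hs : ∀ x ∈ Metric.closedBall (0 : E n) r, ‖(model μ M β w γ u T).2 x‖ ≤ 3 * M :=
    fun x hx => by
      rw [mem_closedBall_zero_iff] at hx
      have hμx : ‖μ • x‖ ≤ M := by
        rw [norm_smul, Real.norm_of_nonneg hμ]
        exact (mul_le_mul_of_nonneg_left hx hμ).trans hμr
      refine norm_model_le (by linarith) fun t ht => ?_
      have hc : ‖μ • center w u t‖ ≤ M := by
        refine abs_le_of_sq_le_sq' ?_ hM |>.2
        rw [norm_smul, mul_pow, norm_sq_center (hu.mono ht.le), Real.norm_eq_abs, sq_abs]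
        refine le_trans (mul_le_mul_of_nonneg_left ?_ (sq_nonneg μ)) hw
        exact Finset.sum_le_sum_of_subset_of_nonneg (Finset.range_mono ht.le)
          fun _ _ _ => sq_nonneg _
      have hut : ‖M • u t‖ = M := by
        have h1 : ‖u t‖ ^ 2 = 1 := by
          rw [← real_inner_self_eq_norm_sq, hu t ht t ht, if_pos rfl]
        rw [norm_smul, Real.norm_of_nonneg hM,
          (pow_eq_one_iff_of_nonneg (norm_nonneg _) two_ne_zero).1 h1, mul_one]
      rw [pieceGrad, smul_sub]
      linarith [norm_sub_le (μ • x - μ • center w u t) (M • u t),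
        norm_sub_le (μ • x) (μ • center w u t)]
  let P := ballProblem n r hr _ _ μ (3 * M) hμ (strongSubgrad_model T) hs
  refine ⟨P, rfl, ?_, ?_, fun t ht => ?_⟩
  · rw [show 6 * M = 2 * (3 * M) by ring]
    exact ballProblem_inClass hr hμ _ hs
  · rw [show 6 * M = 2 * (3 * M) by ring]
    exact ballProblem_isLip hr hμ _ hs
  · have hα' : ‖center α u T‖ ≤ r := by
      refine abs_le_of_sq_le_sq' ?_ hr |>.2
      rwa [norm_sq_center hu]
    have hmin : P.minVal ≤ b :=
      (P.minVal_le (x := center α u T) (mem_closedBall_zero_iff.2 hα')).trans (hb u hu)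
    have hq : γ t ≤ P.f (B.query P t) := by
      rw [BaseAlg.query, B.history_eq_run]
      exact (piece_of_orthogonal hμ (hux t t le_rfl ht)).trans (piece_le_model ht _)
    linarith

/-! ### Parameters for the convex and the strongly convex Lipschitz classes -/

theorem regretAtLeast_lipschitzClass {M R : ℝ} {T n K : ℕ} (hM : 0 < M) (hR : 0 < R)
    (hT : 0 < T) (hn : 2 * T ≤ n) (hK : 0 < K) :
    RegretAtLeast (lipschitzClass n M R) K T (1 / 12 * (M * R * √(T : ℝ))) := by
  refine regretAtLeast_of_base hK fun B _ => ?_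
  have hT' : (0 : ℝ) < √(T : ℝ) := Real.sqrt_pos.2 (by exact_mod_cast hT)
  have hTs : √(T : ℝ) ^ 2 = T := Real.sq_sqrt (Nat.cast_nonneg T)
  -- The point `∑ α u_i` has norm `α √T = R / 2`, and there every piece equals `-(M / 6) α`. Each
  -- gap is at least `MR / (12 √T)`.
  let α : ℝ := R / 2 / √(T : ℝ)
  obtain ⟨P, hdom, hclass, hlip, hgap⟩ := exists_resisting_problem (n := n) (T := T) (μ := 0)
    (M := M / 6) (r := R / 2) (β := M / 6 * α) (b := -(M / 6 * α)) (w := 0) (γ := 0)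
    (α := fun _ => α) le_rfl (by positivity) (by positivity) (by simp) hn (by simp; positivity)
    (by simp; positivity)
    (by
      simp only [Finset.sum_const, Finset.card_range, nsmul_eq_mul, α, div_pow, hTs]
      apply le_of_eq
      field_simp)
    (fun u hu => model_le (by simp) fun t ht => by
      rw [piece, real_inner_smul_left, inner_center hu ht]
      simp) B
  rw [show 6 * (M / 6) = M by ring] at hclass hlip
  refine ⟨P, ⟨by rw [hdom], ?_, hclass, hlip⟩, ?_⟩
  · rw [HasDiam, hdom]
    exact ⟨Metric.isBounded_closedBall, diam_closedBall_half (n := n) (by omega) hR.le⟩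
  · refine le_trans (le_of_eq ?_) (Finset.sum_le_sum fun t ht => hgap t (Finset.mem_range.1 ht))
    simp only [Pi.zero_apply, sub_neg_eq_add, zero_add, Finset.sum_const, Finset.card_range,
      nsmul_eq_mul, α]
    nth_rewrite 2 [← hTs]
    field_simp
    ring

/-- This amounts to `i + 2 ≤ 2 (i + 1)`; the right side telescopes. -/
theorem inv_sq_le_sub (i : ℕ) :
    1 / ((i : ℝ) + 1) ^ 2 ≤ 2 * (1 / ((i : ℝ) + 1) - 1 / ((i : ℝ) + 1 + 1)) := by
  rw [div_sub_div _ _ (by positivity) (by positivity), mul_div_assoc', div_le_div_iff₀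
    (by positivity) (by positivity)]
  have : (0 : ℝ) ≤ i := Nat.cast_nonneg i
  nlinarith [mul_nonneg this this]

theorem sum_inv_sq_le {t T : ℕ} (h : t ≤ T) :
    ∑ i ∈ Finset.Ico t T, 1 / ((i : ℝ) + 1) ^ 2 ≤
      2 * (1 / ((t : ℝ) + 1) - 1 / ((T : ℝ) + 1)) := by
  induction T, h using Nat.le_induction with
  | base => simp
  | succ T hT ih =>
    rw [Finset.sum_Ico_succ_top hT, Nat.cast_add_one]
    linarith [inv_sq_le_sub T]

theorem regretAtLeast_strongLipschitzClass {μ M : ℝ} {T n K : ℕ} (hμ : 0 < μ) (hM : 0 < M)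
    (hn : 2 * T ≤ n) (hK : 0 < K) :
    RegretAtLeast (strongLipschitzClass n μ M) K T (1 / 144 * (M ^ 2 / μ * Real.log T)) := by
  refine regretAtLeast_of_base hK fun B _ => ?_
  let m : ℝ := M / 6
  have hm : 0 < m := by positivity
  -- These are balanced so that `m * w t = 2 * γ t`, while the tail `μ/2 ∑_{i ≥ t} w i ^ 2` is at
  -- most `γ t`.
  let w : ℕ → ℝ := fun i => m / μ * (1 / (2 * ((i : ℝ) + 1)))
  let γ : ℕ → ℝ := fun t => m ^ 2 / μ * (1 / 4 * (1 / ((t : ℝ) + 1)))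
  have hw2 : ∀ i, w i ^ 2 = (m / μ) ^ 2 / 4 * (1 / ((i : ℝ) + 1) ^ 2) := fun i => by
    simp only [w]
    field_simp
    ring
  have hsum : ∀ t ≤ T,
      ∑ i ∈ Finset.Ico t T, w i ^ 2 ≤ (m / μ) ^ 2 / 2 * (1 / ((t : ℝ) + 1)) := fun t ht => by
    simp only [hw2]
    rw [← Finset.mul_sum]
    have h1 : ∑ i ∈ Finset.Ico t T, 1 / ((i : ℝ) + 1) ^ 2 ≤ 2 * (1 / ((t : ℝ) + 1)) := by
      have : (0 : ℝ) ≤ 1 / ((T : ℝ) + 1) := by positivity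
      linarith [sum_inv_sq_le ht]
    calc _ ≤ (m / μ) ^ 2 / 4 * (2 * (1 / ((t : ℝ) + 1))) := by gcongr
      _ = _ := by ring
  have hsum0 : ∑ i ∈ Finset.range T, w i ^ 2 ≤ (m / μ) ^ 2 / 2 := by
    have := hsum 0 (Nat.zero_le T)
    simpa using this
  have hmμ : 0 ≤ (m / μ) ^ 2 := by positivity
  have hμm : μ * (m / μ) ^ 2 = m ^ 2 / μ := by
    field_simp
  obtain ⟨P, hdom, hclass, hlip, hgap⟩ := exists_resisting_problem (n := n) (T := T) (μ := μ)
    (M := m) (r := m / μ) (β := m ^ 2 / μ / 4) (b := 0) (w := w) (γ := γ) (α := w) hμ.le hm.le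
    (by positivity)
    (fun i => by
      simp only [γ, Nat.cast_add_one]
      have h1 := mul_le_mul_of_nonneg_left (inv_sq_le_sub i)
        (show 0 ≤ m ^ 2 / μ / 8 by positivity)
      have h2 : μ / 2 * w i ^ 2 = m ^ 2 / μ / 8 * (1 / ((i : ℝ) + 1) ^ 2) := by
        rw [hw2, ← hμm]
        ring
      rw [h2]
      linarith)
    hn (by rw [mul_div_cancel₀ _ hμ.ne'])
    (by
      refine (mul_le_mul_of_nonneg_left hsum0 (sq_nonneg μ)).trans ?_
      rw [mul_div_assoc', ← mul_pow, mul_div_cancel₀ _ hμ.ne']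
      linarith [sq_nonneg m])
    (by linarith)
    -- The comparison point is the last center. There piece `t` is at most `γ t - 2 γ t + γ t = 0`,
    -- and `β` cancels the bound on the basic quadratic.
    (fun u hu => model_le (by
      rw [norm_sq_center hu]
      have := mul_le_mul_of_nonneg_left hsum0 hμ.le
      linarith) fun t ht => by
      rw [piece, norm_sq_center_sub_center hu ht.le, real_inner_smul_left, inner_center hu ht]
      have h1 := mul_le_mul_of_nonneg_left (hsum t ht.le) hμ.le
      have h2 : μ * ((m / μ) ^ 2 / 2 * (1 / ((t : ℝ) + 1))) = 2 * γ t := by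
        simp only [γ]
        rw [← hμm]
        ring
      have h3 : m * w t = 2 * γ t := by
        simp only [γ, w]
        field_simp
        ring
      linarith) B
  rw [show 6 * m = M by simp only [m]; ring] at hclass hlip
  refine ⟨P, ⟨by rw [hdom], hclass, hlip⟩, ?_⟩
  refine le_trans ?_ (Finset.sum_le_sum fun t ht => hgap t (Finset.mem_range.1 ht))
  have hlog := log_le_sum_inv T
  rw [← Finset.Ico_add_one_right_eq_Icc, Finset.sum_Ico_eq_sum_range, Nat.add_sub_cancel] at hlog
  simp only [sub_zero, γ]
  rw [← Finset.mul_sum, ← Finset.mul_sum]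
  have h1 : ∑ i ∈ Finset.range T, 1 / ((1 + i : ℕ) : ℝ) =
      ∑ i ∈ Finset.range T, 1 / ((i : ℝ) + 1) :=
    Finset.sum_congr rfl fun i _ => by rw [Nat.cast_add, Nat.cast_one, add_comm]
  rw [h1] at hlog
  calc 1 / 144 * (M ^ 2 / μ * Real.log T) = m ^ 2 / μ * (1 / 4 * Real.log T) := by
        simp only [m]
        ring
    _ ≤ _ := by gcongr

end FMAB
-- The general bound, the four rates and the standard classes
theorem mainTheorem3 :
    -- the general lower bound
    (∀ (Ω : ℕ → Type*) (F : Set (FMAB.Problem Ω)) (g : FMAB.Problem Ω → ℕ → ℝ) (T K : ℕ),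
      0 < K → FMAB.IsOracleLowerBound F g T →
      (∀ s ∈ Finset.Icc 1 T, BddBelow ((fun P => g P s) '' F)) →
      FMAB.RegretAtLeast F K T
        (⨅ k : {k : Fin K → ℕ // ∑ i, k i = T}, ∑ i, FMAB.cumHardness F g (k.1 i))) ∧
    -- the orders that follow from the four rates of the hardness
    (∀ (Ω : ℕ → Type*) (F : Set (FMAB.Problem Ω)) (g : FMAB.Problem Ω → ℕ → ℝ) (T K : ℕ),
      0 < T → 0 < K → FMAB.IsOracleLowerBound F g T →
      ∀ c : ℝ, 0 < c →
        (∀ M R : ℝ, 0 < M → 0 < R →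
          (∀ s ∈ Finset.Icc 1 T, c * (M * R / √(s : ℝ)) ≤ FMAB.hardness F g s) →
          (∀ m ∈ Finset.Icc 1 T, c * (M * R * √(m : ℝ)) ≤ FMAB.cumHardness F g m) ∧
          FMAB.RegretAtLeast F K T (c * (M * R * √(T : ℝ)))) ∧
        (∀ L R : ℝ, 0 < L → 0 < R →
          (∀ s ∈ Finset.Icc 1 T, c * (L * R ^ 2 / (s : ℝ) ^ 2) ≤ FMAB.hardness F g s) →
          (∀ m ∈ Finset.Icc 1 T, c * (L * R ^ 2) ≤ FMAB.cumHardness F g m) ∧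
          FMAB.RegretAtLeast F K T (c * (L * R ^ 2))) ∧
        (∀ μ M : ℝ, 0 < μ → 0 < M →
          (∀ s ∈ Finset.Icc 1 T, c * (M ^ 2 / (μ * (s : ℝ))) ≤ FMAB.hardness F g s) →
          (∀ m ∈ Finset.Icc 1 T,
            c * (M ^ 2 / μ * Real.log (m : ℝ)) ≤ FMAB.cumHardness F g m) ∧
          FMAB.RegretAtLeast F K T (c * (M ^ 2 / μ * Real.log (T : ℝ)))) ∧
        (∀ μ L R : ℝ, 0 < μ → μ ≤ L → 0 < R →
          (∀ s ∈ Finset.Icc 1 T,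
            c * (R ^ 2 * Real.exp (-(s : ℝ) / √(L / μ))) ≤ FMAB.hardness F g s) →
          (∀ m ∈ Finset.Icc 1 T, c * Real.exp (-1) * R ^ 2 ≤ FMAB.cumHardness F g m) ∧
          FMAB.RegretAtLeast F K T (c * Real.exp (-1) * R ^ 2))) ∧
    -- the four standard classes with a first-order oracle
    (∃ c : ℝ, 0 < c ∧
      (∀ (M R : ℝ) (T n K : ℕ), 0 < M → 0 < R → 0 < T → 2 * T ≤ n → 0 < K →
        FMAB.RegretAtLeast (FMAB.lipschitzClass n M R) K T (c * (M * R * √(T : ℝ)))) ∧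
      (∀ (L R : ℝ) (T n K : ℕ), 0 < L → 0 < R → 0 < T → 0 < n → 0 < K →
        FMAB.RegretAtLeast (FMAB.smoothClass n L R) K T (c * (L * R ^ 2))) ∧
      (∀ (μ M : ℝ) (T n K : ℕ), 0 < μ → 0 < M → 0 < T → 2 * T ≤ n → 0 < K →
        FMAB.RegretAtLeast (FMAB.strongLipschitzClass n μ M) K T
          (c * (M ^ 2 / μ * Real.log (T : ℝ)))) ∧
      (∀ (μ L R : ℝ) (T n K : ℕ), 0 < μ → μ ≤ L → 0 < R → 0 < T → 0 < n → 0 < K →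
        FMAB.RegretAtLeast (FMAB.strongSmoothClass n μ L R) K T (c * (L * R ^ 2)))) := by
  -- The common constant `1 / 144` is the smallest of `1 / 12`, `1 / 8` and `1 / 144`.
  refine ⟨fun Ω F g T K hK hg hb => ?_, fun Ω F g T K hT hK hg c hc =>
    ⟨fun M R hM hR h => ?_, fun L R hL hR h => ?_, fun μ M hμ hM h => ?_,
      fun μ L R hμ hμL hR h => ?_⟩, 1 / 144, by norm_num, fun M R T n K hM hR hT hn hK => ?_,
    fun L R T n K hL hR hT hn hK => ?_, fun μ M T n K hμ hM hT hn hK => ?_,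
    fun μ L R T n K hμ hμL hR hT hn hK => ?_⟩
  · exact (FMAB.regretAtLeast_cumHardness hK hg hb).mono (FMAB.iInf_sum_cumHardness_le hK)
  · refine FMAB.rate_of_hardness (b := fun m => c * (M * R * √(m : ℝ))) hT hK hg (fun s hs => ?_)
      h fun m _ => ?_
    · have : (0 : ℝ) < s := by exact_mod_cast (Finset.mem_Icc.1 hs).1
      positivity
    · have h1 := mul_le_mul_of_nonneg_left (FMAB.sqrt_le_sum_inv_sqrt m)
        (show 0 ≤ c * (M * R) by positivity)
      rw [Finset.mul_sum] at h1
      refine le_trans (le_of_eq (by ring)) (h1.trans_eq ?_)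
      exact Finset.sum_congr rfl fun s _ => by ring
  · refine FMAB.rate_of_hardness (b := fun _ => c * (L * R ^ 2)) hT hK hg (fun s hs => ?_)
      h fun m hm => ?_
    · have : (0 : ℝ) < s := by exact_mod_cast (Finset.mem_Icc.1 hs).1
      positivity
    · have h1 := FMAB.first_le_sum (a := fun s : ℕ => c * (L * R ^ 2 / (s : ℝ) ^ 2))
        (Finset.mem_Icc.1 hm).1 fun s _ => by positivity
      simpa using h1
  · refine FMAB.rate_of_hardness (b := fun m => c * (M ^ 2 / μ * Real.log (m : ℝ))) hT hK hg
      (fun s hs => ?_) h fun m _ => ?_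
    · have : (0 : ℝ) < s := by exact_mod_cast (Finset.mem_Icc.1 hs).1
      positivity
    · have h1 := mul_le_mul_of_nonneg_left (FMAB.log_le_sum_inv m)
        (show 0 ≤ c * (M ^ 2 / μ) by positivity)
      rw [Finset.mul_sum] at h1
      refine le_trans (le_of_eq (by ring)) (h1.trans_eq ?_)
      exact Finset.sum_congr rfl fun s _ => by rw [← div_div]; ring
  · refine FMAB.rate_of_hardness (b := fun _ => c * Real.exp (-1) * R ^ 2) hT hK hg
      (fun s hs => by positivity) h fun m hm => ?_
    refine le_trans ?_ (FMAB.first_le_sum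
      (a := fun s : ℕ => c * (R ^ 2 * Real.exp (-(s : ℝ) / √(L / μ))))
      (Finset.mem_Icc.1 hm).1 fun s _ => by positivity)
    -- The first summand suffices: `κ ≥ 1` gives `exp (-1 / √κ) ≥ exp (-1)`.
    have h1 : 1 ≤ √(L / μ) := Real.one_le_sqrt.2 ((one_le_div hμ).2 hμL)
    have h2 : Real.exp (-1) ≤ Real.exp (-((1 : ℕ) : ℝ) / √(L / μ)) := by
      rw [Real.exp_le_exp, Nat.cast_one, neg_div, neg_le_neg_iff]
      exact div_le_one_of_le₀ h1 (Real.sqrt_nonneg _)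
    calc c * Real.exp (-1) * R ^ 2 = c * (R ^ 2 * Real.exp (-1)) := by ring
      _ ≤ _ := by gcongr
  · refine (FMAB.regretAtLeast_lipschitzClass hM hR hT hn hK).mono ?_
    gcongr
    norm_num
  · rw [← FMAB.strongSmoothClass_zero]
    refine (FMAB.regretAtLeast_strongSmoothClass hL.le hL hR hT hn hK).mono ?_
    gcongr
    norm_num
  · exact FMAB.regretAtLeast_strongLipschitzClass hμ hM hn hK
  · refine (FMAB.regretAtLeast_strongSmoothClass hμL (hμ.trans_le hμL) hR hT hn hK).mono ?_
    have := hμ.trans_le hμL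
    gcongr
    norm_num
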